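/- Let $\Omega=(a,b)$ be a non-empty bounded open interval in $\mathbb{R}$ and let $1\le p\le 4$. Let $W^{2,p}(\Omega)$ be the space of all $u\in L^p(\Omega)$ that have weak derivatives $u',u''\in L^p(\Omega)$. For each $\epsilon>0$ define $F_\epsilon:L^p(\Omega)\to\overline{\mathbb{R}}$ by $$F_\epsilon(u):=\begin{cases}\displaystyle\int_\Omega \epsilon^{-1}(u^2-1)^2+\epsilon^3|u''|^2\,dx, & u\in W^{2,p}(\Omega),\\ +\infty, & \text{otherwise.}\end{cases}$$ Let $BPV(\Omega;\{-1,1\})$ be the set of all $u\in L^p(\Omega)$ that have a representative $\tilde u:\Omega\to\{-1,1\}$ of finite pointwise variation $$\operatorname{Var}_\Omega\tilde u=\sup\Big\{\sum_{i=1}^m|\tilde u(x_i)-\tilde u(x_{i-1})| : x_0<x_1<\dots<x_m,\ x_i\in\Omega\Big\}.$$ Let $(\epsilon_n)_{n\in\mathbb{N}}$ be a sequence of positive reals with $\epsilon_n\to0$, and let $(u_n)_{n\in\mathbb{N}}$ be a sequence in $L^p(\Omega)$ with $\sup_{n\in\mathbb{N}}|F_{\epsilon_n}(u_n)|<\infty$.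 Then there are a subsequence $(u_{n_k})_k$ and a function $u\in BPV(\Omega;\{-1,1\})$ such that $u_{n_k}\to u$ in $L^p(\Omega)$. -/

import Mathlib

open MeasureTheory Set Filter Topology
open scoped ENNReal ContDiff

/-- The space `L^p(Ω)` of (classes of) real functions on `Ω ⊆ ℝ`, with Lebesgue measure. -/
abbrev LpOn (Ω : Set ℝ) (p : ℝ≥0∞) : Type := Lp ℝ p (volume.restrict Ω)

/-- `v` is a weak derivative of order `k` of `u` on `Ω`, tested against `C_c^∞(Ω)`. -/
def IsWeakDeriv (Ω : Set ℝ) (k : ℕ) (u v : ℝ → ℝ) : Prop :=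
  ∀ φ : ℝ → ℝ, ContDiff ℝ ∞ φ → HasCompactSupport φ → tsupport φ ⊆ Ω →
    ∫ x in Ω, u x * iteratedDeriv k φ x = (-1) ^ k * ∫ x in Ω, v x * φ x

/-- `u ∈ L^p(Ω)` admits a weak derivative of order `k` in `L^p(Ω)`. -/
def HasWeakDeriv {Ω : Set ℝ} {p : ℝ≥0∞} (k : ℕ) (u : LpOn Ω p) : Prop :=
  ∃ v : LpOn Ω p, IsWeakDeriv Ω k u v

open Classical in
/-- The weak derivative of order `k` of `u ∈ L^p(Ω)` (and `0` if there is none). -/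
noncomputable def weakDeriv {Ω : Set ℝ} {p : ℝ≥0∞} (k : ℕ) (u : LpOn Ω p) : LpOn Ω p :=
  if h : HasWeakDeriv k u then h.choose else 0

/-- `u ∈ W^{k,p}(Ω)`. -/
def MemSobolev {Ω : Set ℝ} {p : ℝ≥0∞} (k : ℕ) (u : LpOn Ω p) : Prop :=
  ∀ l : ℕ, 1 ≤ l → l ≤ k → HasWeakDeriv l u

open Classical in
/-- The functional `F_ε` on `L^p(Ω)`: it is `∫_Ω ε⁻¹ (u² - 1)² + ε³ |u''|² dx` on `W^{2,p}(Ω)`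
and `+∞` elsewhere. The integrand is nonnegative for `ε > 0`, so the values are in `[0, ∞]`. -/
noncomputable def secondOrderEnergy {Ω : Set ℝ} {p : ℝ≥0∞} (ε : ℝ) (u : LpOn Ω p) : ℝ≥0∞ :=
  if MemSobolev 2 u then
    ∫⁻ x in Ω, ENNReal.ofReal (ε⁻¹ * ((u x) ^ 2 - 1) ^ 2 + ε ^ 3 * |weakDeriv 2 u x| ^ 2)
  else ⊤

/-- `u ∈ BPV(Ω; A)`: the class `u` has a representative on `Ω` with values in `A` and with finite
pointwise variation on `Ω`. -/
def MemBPV {Ω : Set ℝ} {p : ℝ≥0∞} (A : Set ℝ) (u : LpOn Ω p) : Prop :=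
  ∃ w : ℝ → ℝ, u =ᵐ[volume.restrict Ω] w ∧ (∀ x ∈ Ω, w x ∈ A) ∧ BoundedVariationOn w Ω

/-!
Write `w` for the `C¹` representative of a function `u` of finite energy, which exists because both
weak derivatives are integrable (`exists_C1_representative`, a one-dimensional du Bois-Reymond
argument).

The energy controls the number of transitions of `w` because each of them has a fixed price: if `w`
vanishes somewhere in an interval whose length is between `ε` and `2 ε`, then the energy on that
interval is at least `1 / 64` (`energy_cell_ge_of_zero`). Indeed, with less energy `w` would be
within `1 / 4` of a linear function vanishing at the zero, and such a function stays away from `±1`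
on a fixed proportion of the interval, whatever its slope.

Cut `(a, b)` into cells of length between `ε` and `2 ε`. If the energy is at most `M`, at most
`K = ⌈64 M⌉` cells contain a zero of `w`. Let `z` be the function equal on each cell to the sign
of `w` at the left endpoint. It jumps only across cells with a zero, hence it is a product of at
most `K + 1` functions `signStep t` with `t ∈ [a, b]`; and off the cells with a zero, which have total
length at most `2 ε K`, it is the sign of `w`, so that `|w - z| = ||w| - 1|`
(`exists_signSteps_approx`). Since `||w| - 1| ^ 4 ≤ (w ^ 2 - 1) ^ 2`, the integral of `|u - z| ^ 4`
is `O(ε)` (`lintegral_sub_signSteps_le`); this is where `p ≤ 4` comes from.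

The functions `z` are parametrized by the compact set `[a, b] ^ (K + 1)`, and they depend on the
parameter continuously in `L⁴` (`tendsto_eLpNorm_signSteps_sub`). A subsequence of the parameters
converges, and the corresponding `u` converge to the product of steps at the limit parameter, which
has values in `{-1, 1}` and bounded variation.
-/

/-! ### Weak derivatives on an interval -/

/-- A test function is the derivative of a test function as soon as its integral vanishes. -/
lemma exists_primitive_testFunction {a b : ℝ} {χ : ℝ → ℝ} (hχ : ContDiff ℝ ∞ χ)
    (hc : HasCompactSupport χ) (hs : tsupport χ ⊆ Ioo a b) (h0 : ∫ x in a..b, χ x = 0) :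
    ∃ φ : ℝ → ℝ, ContDiff ℝ ∞ φ ∧ HasCompactSupport φ ∧ tsupport φ ⊆ Ioo a b ∧ deriv φ = χ := by
  obtain ⟨c, d, hac, hdb, hcd⟩ : ∃ c d, a < c ∧ d < b ∧ tsupport χ ⊆ Icc c d := by
    rcases (tsupport χ).eq_empty_or_nonempty with h | h
    · exact ⟨a + 1, b - 1, by linarith, by linarith, by simp [h]⟩
    · have hc' : IsCompact (tsupport χ) := hc
      obtain ⟨c, hcm, hcl⟩ := hc'.exists_isLeast h
      obtain ⟨d, hdm, hdl⟩ := hc'.exists_isGreatest h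
      exact ⟨c, d, (hs hcm).1, (hs hdm).2, fun x hx => ⟨hcl hx, hdl hx⟩⟩
  have hz : ∀ x, x ∉ Icc c d → χ x = 0 := fun x hx =>
    image_eq_zero_of_notMem_tsupport fun h => hx (hcd h)
  have hd : ∀ x, HasDerivAt (fun y => ∫ t in a..y, χ t) (χ x) x := fun x =>
    hχ.continuous.integral_hasStrictDerivAt a x |>.hasDerivAt
  have hd' : deriv (fun y => ∫ t in a..y, χ t) = χ := funext fun x => (hd x).deriv
  -- The primitive vanishes to the right of `d` because `χ` has integral zero.
  have hsub : tsupport (fun y => ∫ t in a..y, χ t) ⊆ Icc c d := by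
    refine closure_minimal (fun x hx => ?_) isClosed_Icc
    by_contra hn
    refine hx ?_
    rw [mem_Icc, not_and_or, not_le, not_le] at hn
    rcases hn with hn | hn
    · refine (intervalIntegral.integral_congr (g := fun _ => (0 : ℝ)) fun t ht => hz t ?_).trans
        (by simp)
      intro h
      have := (mem_uIcc.1 ht)
      rcases this with h1 | h1 <;> linarith [h.1, h1.2]
    · have h1 : ∫ t in b..x, χ t = 0 := by
        refine (intervalIntegral.integral_congr (g := fun _ => (0 : ℝ)) fun t ht => hz t ?_).trans
          (by simp)
        intro h
        rcases mem_uIcc.1 ht with h1 | h1 <;> linarith [h.2, h1.1]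
      have := intervalIntegral.integral_add_adjacent_intervals
        (hχ.continuous.intervalIntegrable (μ := volume) a b)
        (hχ.continuous.intervalIntegrable b x)
      simp only [h0, h1] at this
      simpa using this.symm
  refine ⟨fun y => ∫ t in a..y, χ t, ?_, ?_, ?_, hd'⟩
  · rw [contDiff_infty_iff_deriv]
    exact ⟨fun x => (hd x).differentiableAt, by rwa [hd']⟩
  · exact isCompact_Icc.of_isClosed_subset (isClosed_tsupport _) hsub
  · exact hsub.trans fun x hx => ⟨hac.trans_le hx.1, hx.2.trans_lt hdb⟩

lemma exists_testFunction_integral_eq_one {a b : ℝ} (hab : a < b) :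
    ∃ ψ : ℝ → ℝ, ContDiff ℝ ∞ ψ ∧ HasCompactSupport ψ ∧ tsupport ψ ⊆ Ioo a b ∧
      ∫ x in a..b, ψ x = 1 := by
  let f : ContDiffBump ((a + b) / 2) :=
    ⟨(b - a) / 8, (b - a) / 4, by linarith, by linarith⟩
  have hsub : tsupport (f.normed volume) ⊆ Ioo a b := by
    rw [f.tsupport_normed_eq]
    intro x hx
    have hx' : |x - (a + b) / 2| ≤ (b - a) / 4 := by simpa [Real.dist_eq] using hx
    rw [abs_le] at hx'
    constructor <;> linarith
  refine ⟨f.normed volume, f.contDiff_normed, f.hasCompactSupport_normed, hsub, ?_⟩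
  rw [intervalIntegral.integral_of_le hab.le, setIntegral_eq_integral_of_forall_compl_eq_zero]
  · exact f.integral_normed
  · intro x hx
    exact image_eq_zero_of_notMem_tsupport fun h => hx (Ioo_subset_Ioc_self (hsub h))

/-- The **du Bois-Reymond lemma**: an integrable function with zero weak derivative is constant.
For a fixed test function `ψ` of integral `1`, every test function `χ` differs from `(∫ χ) ψ` by the
derivative of a test function, so `f` and the constant `∫ f ψ` have the same integral against
`χ`. -/
lemma ae_eq_const_of_integral_mul_deriv_eq_zero {a b : ℝ} (hab : a < b) {f : ℝ → ℝ}
    (hf : IntegrableOn f (Ioo a b))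
    (h : ∀ φ : ℝ → ℝ, ContDiff ℝ ∞ φ → HasCompactSupport φ → tsupport φ ⊆ Ioo a b →
      ∫ x in Ioo a b, f x * deriv φ x = 0) :
    ∃ C : ℝ, ∀ᵐ x ∂volume.restrict (Ioo a b), f x = C := by
  obtain ⟨ψ, hψ, hψc, hψs, hψ1⟩ := exists_testFunction_integral_eq_one hab
  have hint : ∀ χ : ℝ → ℝ, ContDiff ℝ ∞ χ → HasCompactSupport χ →
      IntegrableOn (fun x => f x * χ x) (Ioo a b) := fun χ hχ hc => by
    obtain ⟨C, hC⟩ := hχ.continuous.bounded_above_of_compact_support hc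
    exact hf.mul_bdd (c := C) hχ.continuous.aestronglyMeasurable (ae_of_all _ hC)
  refine ⟨∫ x in Ioo a b, f x * ψ x, ?_⟩
  set C := ∫ x in Ioo a b, f x * ψ x with hC
  have key : ∀ᵐ x, x ∈ Ioo a b → f x - C = 0 := by
    refine isOpen_Ioo.ae_eq_zero_of_integral_contDiff_smul_eq_zero
      (IntegrableOn.locallyIntegrableOn (hf.sub (integrableOn_const (by simp)))) ?_
    intro χ hχ hχc hχs
    have hg : ContDiff ℝ ∞ (fun x => χ x - (∫ x in a..b, χ x) * ψ x) :=
      hχ.sub (contDiff_const.mul hψ)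
    have hsub : tsupport (fun x => χ x - (∫ x in a..b, χ x) * ψ x) ⊆ tsupport χ ∪ tsupport ψ := by
      refine closure_minimal (fun x hx => ?_) ((isClosed_tsupport _).union (isClosed_tsupport _))
      by_contra hn
      rw [mem_union, not_or] at hn
      refine hx ?_
      simp [image_eq_zero_of_notMem_tsupport hn.1, image_eq_zero_of_notMem_tsupport hn.2]
    obtain ⟨φ, h1, h2, h3, h4⟩ := exists_primitive_testFunction (a := a) (b := b) hg
      ((IsCompact.union hχc hψc).of_isClosed_subset (isClosed_tsupport _) hsub)
      (hsub.trans (union_subset hχs hψs)) (by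
        rw [intervalIntegral.integral_sub (hχ.continuous.intervalIntegrable _ _)
          ((hψ.continuous.intervalIntegrable _ _).const_mul _),
          intervalIntegral.integral_const_mul, hψ1]
        ring)
    have h5 := h φ h1 h2 h3
    rw [h4] at h5
    rw [← setIntegral_eq_integral_of_forall_compl_eq_zero (s := Ioo a b) (fun x hx => by
      simp [image_eq_zero_of_notMem_tsupport fun h => hx (hχs h)])]
    have e1 : ∀ x, f x * (χ x - (∫ x in a..b, χ x) * ψ x)
      = f x * χ x - (∫ x in a..b, χ x) * (f x * ψ x) := fun x => by ring
    have e2 : ∀ x, χ x • (f x - C) = f x * χ x - C * χ x := fun x => by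
      simp only [smul_eq_mul]; ring
    have hχi : IntegrableOn χ (Ioo a b) :=
      (hχ.continuous.integrable_of_hasCompactSupport hχc).integrableOn
    simp only [e1] at h5
    simp only [e2]
    rw [integral_sub (hint χ hχ hχc) ((hint ψ hψ hψc).const_mul _), integral_const_mul, ← hC,
      intervalIntegral.integral_of_le hab.le, integral_Ioc_eq_integral_Ioo] at h5
    rw [integral_sub (hint χ hχ hχc) (hχi.const_mul _), integral_const_mul]
    linarith
  rw [ae_restrict_iff' measurableSet_Ioo]
  filter_upwards [key] with x hx hxm
  linarith [hx hxm]

/-- A function with an integrable weak derivative `g` is a.e. a primitive of `g`. For convenience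
`g` is integrable on all of `ℝ`; only its values on `(a, b)` matter. -/
lemma ae_eq_primitive_of_weak_deriv {a b : ℝ} (hab : a < b) {f g : ℝ → ℝ}
    (hf : IntegrableOn f (Ioo a b)) (hg : Integrable g)
    (h : ∀ φ : ℝ → ℝ, ContDiff ℝ ∞ φ → HasCompactSupport φ → tsupport φ ⊆ Ioo a b →
      ∫ x in Ioo a b, f x * deriv φ x = -∫ x in Ioo a b, g x * φ x) :
    ∃ C : ℝ, ∀ᵐ x ∂volume.restrict (Ioo a b), f x = C + ∫ t in a..x, g t := by
  have hgi : IntervalIntegrable g volume a b := hg.intervalIntegrable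
  have hGc : Continuous fun x => ∫ t in a..x, g t :=
    intervalIntegral.continuous_primitive (fun _ _ => hg.intervalIntegrable) a
  have hGi : IntegrableOn (fun x => ∫ t in a..x, g t) (Ioo a b) :=
    (hGc.continuousOn.integrableOn_compact isCompact_Icc).mono_set Ioo_subset_Icc_self
  have hGac := hgi.absolutelyContinuousOnInterval_intervalIntegral (c := a) (by simp)
  obtain ⟨C, hC⟩ := ae_eq_const_of_integral_mul_deriv_eq_zero hab (hf.sub hGi) (by
    intro φ hφ hφc hφs
    have hφ' : Continuous (deriv φ) := hφ.continuous_deriv (by simp)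
    have hφ'c : HasCompactSupport (deriv φ) := hφc.deriv
    obtain ⟨D, hD⟩ := hφ'.bounded_above_of_compact_support hφ'c
    have hmul : ∀ k : ℝ → ℝ, IntegrableOn k (Ioo a b) →
        IntegrableOn (fun x => k x * deriv φ x) (Ioo a b) := fun k hk =>
      hk.mul_bdd (c := D) hφ'.aestronglyMeasurable (ae_of_all _ hD)
    have hφa : φ a = 0 := image_eq_zero_of_notMem_tsupport fun h => (hφs h).1.false
    have hφb : φ b = 0 := image_eq_zero_of_notMem_tsupport fun h => (hφs h).2.false
    have hφac : AbsolutelyContinuousOnInterval φ a b :=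
      (hφ.of_le (by simp)).contDiffOn.absolutelyContinuousOnInterval
    have h1 := hGac.integral_mul_deriv_eq_deriv_mul hφac
    have h2 : ∫ x in a..b, deriv (fun x => ∫ t in a..x, g t) x * φ x = ∫ x in a..b, g x * φ x := by
      refine intervalIntegral.integral_congr_ae ?_
      filter_upwards [hgi.ae_hasDerivAt_integral] with x hx hxm
      rw [(hx (uIoc_subset_uIcc hxm) a (by simp)).deriv]
    have hset : ∀ k : ℝ → ℝ, ∫ x in a..b, k x = ∫ x in Ioo a b, k x := fun k => by
      rw [intervalIntegral.integral_of_le hab.le, integral_Ioc_eq_integral_Ioo]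
    rw [h2, hφa, hφb, hset, hset fun x => g x * φ x] at h1
    simp only [Pi.sub_apply, sub_mul]
    rw [integral_sub (hmul _ hf) (hmul _ hGi), h φ hφ hφc hφs, h1]
    ring)
  refine ⟨C, ?_⟩
  filter_upwards [hC] with x hx
  simp only [Pi.sub_apply] at hx
  linarith

/-- A function `u ∈ W^{2,p}(a, b)` is a.e. equal to a `C¹` function `w` whose derivative `w'` is a
primitive of the weak second derivative of `u`. Extending that derivative by `0` outside `(a, b)`
allows `w` and `w'` to be defined on all of `ℝ`. -/
lemma exists_C1_representative {a b : ℝ} (hab : a < b) {p : ℝ≥0∞} [hp : Fact (1 ≤ p)]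
    {u : LpOn (Ioo a b) p} (hu : MemSobolev 2 u) :
    ∃ w w' : ℝ → ℝ, u =ᵐ[volume.restrict (Ioo a b)] w ∧ (∀ x, HasDerivAt w (w' x) x) ∧
      Integrable ((Ioo a b).indicator (weakDeriv 2 u)) ∧
      ∀ x y, w' y - w' x = ∫ t in x..y, (Ioo a b).indicator (weakDeriv 2 u) t := by
  have hint : ∀ f : LpOn (Ioo a b) p, IntegrableOn f (Ioo a b) := fun f =>
    (Lp.memLp f).integrable hp.out
  obtain ⟨u₁, hu₁⟩ := hu 1 le_rfl one_le_two
  have h2 : HasWeakDeriv 2 u := hu 2 one_le_two le_rfl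
  have hv : IsWeakDeriv (Ioo a b) 2 u (weakDeriv 2 u) := by
    rw [weakDeriv, dif_pos h2]; exact h2.choose_spec
  set v := (Ioo a b).indicator (weakDeriv 2 u) with hvdef
  have hvi : Integrable v := (integrable_indicator_iff measurableSet_Ioo).2 (hint _)
  have hmul : ∀ (k φ : ℝ → ℝ), ∫ x in Ioo a b, (Ioo a b).indicator k x * φ x =
      ∫ x in Ioo a b, k x * φ x := fun k φ =>
    setIntegral_congr_fun measurableSet_Ioo fun x hx => by simp [indicator_of_mem hx]
  obtain ⟨D, hD⟩ := ae_eq_primitive_of_weak_deriv hab (hint u₁) hvi (by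
    intro φ hφ hφc hφs
    have hφ' : ContDiff ℝ ∞ (deriv φ) := (contDiff_infty_iff_deriv.1 hφ).2
    have e1 := hu₁ _ hφ' hφc.deriv ((tsupport_deriv_subset).trans hφs)
    have e2 := hv φ hφ hφc hφs
    rw [hvdef, hmul]
    simp only [iteratedDeriv_succ, iteratedDeriv_zero] at e1 e2
    linarith)
  have hw'c : Continuous fun x => D + ∫ t in a..x, v t := continuous_const.add
    (intervalIntegral.continuous_primitive (fun _ _ => hvi.intervalIntegrable) a)
  obtain ⟨C, hC⟩ := ae_eq_primitive_of_weak_deriv hab (hint u)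
    (g := (Ioo a b).indicator u₁) ((integrable_indicator_iff measurableSet_Ioo).2 (hint _)) (by
    intro φ hφ hφc hφs
    have e1 := hu₁ _ hφ hφc hφs
    rw [hmul]
    simp only [iteratedDeriv_succ, iteratedDeriv_zero] at e1
    linarith)
  refine ⟨fun x => C + ∫ s in a..x, (D + ∫ t in a..s, v t), fun x => D + ∫ t in a..x, v t,
    ?_, ?_, hvi, ?_⟩
  · filter_upwards [hC, ae_restrict_mem measurableSet_Ioo] with x hx hxm
    rw [hx]
    congr 1
    refine intervalIntegral.integral_congr_ae ?_
    rw [ae_restrict_iff' measurableSet_Ioo] at hD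
    filter_upwards [hD] with s hs hsm
    rw [uIoc_of_le hxm.1.le] at hsm
    have : s ∈ Ioo a b := ⟨hsm.1, hsm.2.trans_lt hxm.2⟩
    rw [indicator_of_mem this, hs this]
  · intro x
    exact ((hw'c.integral_hasStrictDerivAt a x).hasDerivAt).const_add C
  · intro x y
    have := intervalIntegral.integral_add_adjacent_intervals
      (hvi.intervalIntegrable (a := a) (b := x)) (hvi.intervalIntegrable (b := y))
    simp only
    linarith

/-! ### The energy of a cell containing a zero -/

/-- A function within `1 / 4` of `t ↦ m t` on `[0, ℓ]` has a double-well integral of order `ℓ`: if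
`m` is small, it has modulus at most `3 / 4` on the first quarter of `[0, ℓ]`; otherwise it has
modulus at least `5 / 4` on the last quarter. -/
lemma le_integral_doubleWell_of_near_linear {ℓ m : ℝ} (hℓ : 0 < ℓ) {W : ℝ → ℝ} (hW : Continuous W)
    (h : ∀ t ∈ Icc 0 ℓ, |W t - m * t| ≤ 1 / 4) :
    49 / 256 * (ℓ / 4) ≤ ∫ t in 0..ℓ, (W t ^ 2 - 1) ^ 2 := by
  have hc : Continuous fun t => (W t ^ 2 - 1) ^ 2 := by fun_prop
  have key : ∀ r, 0 ≤ r → r + ℓ / 4 ≤ ℓ →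
      (∀ t ∈ Icc r (r + ℓ / 4), 7 / 16 ≤ |W t ^ 2 - 1|) →
      49 / 256 * (ℓ / 4) ≤ ∫ t in 0..ℓ, (W t ^ 2 - 1) ^ 2 := by
    intro r hr hrl hb
    calc 49 / 256 * (ℓ / 4) = ∫ t in r..(r + ℓ / 4), (49 / 256 : ℝ) := by simp; ring
      _ ≤ ∫ t in r..(r + ℓ / 4), (W t ^ 2 - 1) ^ 2 := by
          refine intervalIntegral.integral_mono_on (by linarith) (by simp)
            (hc.intervalIntegrable _ _) fun t ht => ?_
          have := hb t ht
          rw [← sq_abs]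
          nlinarith
      _ ≤ _ := intervalIntegral.integral_mono_interval hr (by linarith) hrl
          (ae_of_all _ fun t => sq_nonneg _) (hc.intervalIntegrable _ _)
  by_cases hm : |m| * (ℓ / 4) ≤ 1 / 2
  · refine key 0 le_rfl (by linarith) fun t ht => ?_
    have h1 := h t ⟨ht.1, by linarith [ht.2]⟩
    have h2 : |m * t| ≤ 1 / 2 := by
      rw [abs_mul, abs_of_nonneg ht.1]
      nlinarith [abs_nonneg m, ht.2]
    have h3 : |W t| ≤ 3 / 4 := by
      have := abs_sub_abs_le_abs_sub (W t) (m * t)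
      linarith
    rw [abs_sub_comm]
    refine le_trans ?_ (le_abs_self _)
    rw [← sq_abs]
    nlinarith [abs_nonneg (W t)]
  · push Not at hm
    refine key (3 * (ℓ / 4)) (by linarith) (by linarith) fun t ht => ?_
    have h1 := h t ⟨by linarith [ht.1], by linarith [ht.2]⟩
    have h2 : 3 / 2 ≤ |m * t| := by
      rw [abs_mul, abs_of_nonneg (by linarith [ht.1] : 0 ≤ t)]
      nlinarith [abs_nonneg m, ht.1]
    have h3 : 5 / 4 ≤ |W t| := by
      have := abs_sub_abs_le_abs_sub (m * t) (W t)
      rw [abs_sub_comm] at this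
      linarith
    refine le_trans ?_ (le_abs_self _)
    rw [← sq_abs]
    nlinarith [abs_nonneg (W t)]

lemma abs_sub_linear_le {w w' : ℝ → ℝ} (hw : ∀ x, HasDerivAt w (w' x) x) {c d x₀ η : ℝ}
    (hx₀ : x₀ ∈ Icc c d) (h : ∀ y ∈ Icc c d, |w' y - w' x₀| ≤ η) {x : ℝ} (hx : x ∈ Icc c d) :
    |w x - w x₀ - w' x₀ * (x - x₀)| ≤ η * |x - x₀| := by
  have := (convex_Icc c d).norm_image_sub_le_of_norm_hasDerivWithin_le
    (f := fun x => w x - w' x₀ * x) (f' := fun x => w' x - w' x₀) (C := η)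
    (fun y _ => by
      have hy := (hw y).sub ((hasDerivAt_id y).const_mul (w' x₀))
      rw [mul_one] at hy
      exact hy.hasDerivWithinAt)
    h hx₀ hx
  simp only [Real.norm_eq_abs] at this
  convert this using 2
  ring

/-- An interval with length between `ε` and `2 ε` in which `w` has a zero carries energy at least
`1 / 64`. The function `v` stands for `w''`, which is only assumed to be integrable. -/
lemma energy_cell_ge_of_zero {w w' v : ℝ → ℝ} (hw : ∀ x, HasDerivAt w (w' x) x)
    (hv : Integrable v) (hw' : ∀ x y, w' y - w' x = ∫ t in x..y, v t)
    {ε c d : ℝ} (hε : 0 < ε) (h1 : ε ≤ d - c) (h2 : d - c ≤ 2 * ε)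
    (he : IntervalIntegrable (fun x => ε⁻¹ * (w x ^ 2 - 1) ^ 2 + ε ^ 3 * |v x| ^ 2) volume c d)
    {x₀ : ℝ} (hx₀ : x₀ ∈ Icc c d) (hz : w x₀ = 0) :
    1 / 64 ≤ ∫ x in c..d, (ε⁻¹ * (w x ^ 2 - 1) ^ 2 + ε ^ 3 * |v x| ^ 2) := by
  by_contra! hlt
  set e : ℝ → ℝ := fun x => ε⁻¹ * (w x ^ 2 - 1) ^ 2 + ε ^ 3 * |v x| ^ 2 with hedef
  have hcd : c ≤ d := by linarith
  have hwc : Continuous w := continuous_iff_continuousAt.2 fun x => (hw x).continuousAt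
  have hvI : ∀ x y, IntervalIntegrable (fun t => |v t|) volume x y := fun x y =>
    hv.norm.intervalIntegrable
  have hvb : ε * ∫ t in c..d, |v t| ≤ 1 / 4 := by
    -- The inequality of arithmetic and geometric means, with weights such that the integral over the
    -- cell, of length at most `2 ε`, is at most `4 / 64 + 1 / 8`.
    have hp : ∀ t, ε * |v t| ≤ 4 * e t + (16 * ε)⁻¹ := fun t => by
      have h3 : 0 ≤ ε⁻¹ * (w t ^ 2 - 1) ^ 2 := by positivity
      have h4 : 0 ≤ ε⁻¹ * (2 * ε ^ 2 * |v t| - 1 / 4) ^ 2 := by positivity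
      have h5 : ε⁻¹ * (2 * ε ^ 2 * |v t| - 1 / 4) ^ 2
          = 4 * (ε ^ 3 * |v t| ^ 2) - ε * |v t| + (16 * ε)⁻¹ := by
        field_simp
        ring
      simp only [hedef]
      linarith
    calc ε * ∫ t in c..d, |v t| = ∫ t in c..d, ε * |v t| := by
          rw [intervalIntegral.integral_const_mul]
      _ ≤ ∫ t in c..d, (4 * e t + (16 * ε)⁻¹) :=
          intervalIntegral.integral_mono_on hcd ((hvI c d).const_mul _)
            ((he.const_mul 4).add (by simp)) fun t _ => hp t
      _ = 4 * (∫ t in c..d, e t) + (d - c) * (16 * ε)⁻¹ := by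
          rw [intervalIntegral.integral_add (he.const_mul 4) (by simp),
            intervalIntegral.integral_const_mul, intervalIntegral.integral_const, smul_eq_mul]
      _ ≤ 4 * (1 / 64) + (2 * ε) * (16 * ε)⁻¹ := by gcongr
      _ ≤ 1 / 4 := by
          have : (2 * ε) * (16 * ε)⁻¹ = 1 / 8 := by field_simp; norm_num
          linarith
  -- Hence on a half cell around the zero `x₀`, `w` is within `ε ∫ |v| ≤ 1 / 4` of its
  -- tangent at `x₀`.
  have hη : ∀ y ∈ Icc c d, |w' y - w' x₀| ≤ ∫ t in c..d, |v t| := by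
    intro y hy
    rw [hw', ← Real.norm_eq_abs]
    refine (intervalIntegral.norm_integral_le_abs_integral_norm).trans ?_
    simp only [Real.norm_eq_abs]
    rw [← abs_of_nonneg (intervalIntegral.integral_nonneg hcd fun t _ => abs_nonneg (v t))]
    refine intervalIntegral.abs_integral_mono_interval ?_ (ae_of_all _ fun t => abs_nonneg _)
      (hvI c d)
    rw [uIoc_of_le hcd]
    exact Ioc_subset_Ioc (le_min hx₀.1 hy.1) (max_le hx₀.2 hy.2)
  -- One of `[x₀, x₀ + ℓ]` and `[x₀ - ℓ, x₀]` is contained in the cell, and `ε / 2 ≤ ℓ ≤ ε`.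
  set ℓ := (d - c) / 2 with hℓ
  have hℓ0 : 0 < ℓ := by linarith
  have hI0 : 0 ≤ ∫ t in c..d, |v t| :=
    intervalIntegral.integral_nonneg hcd fun t _ => abs_nonneg (v t)
  have hlin : ∀ x ∈ Icc c d, |x - x₀| ≤ ℓ → |w x - w' x₀ * (x - x₀)| ≤ 1 / 4 := by
    intro x hx hxl
    have := abs_sub_linear_le hw hx₀ hη hx
    rw [hz, sub_zero] at this
    refine this.trans (le_trans ?_ hvb)
    rw [mul_comm]
    gcongr
    linarith
  have hWc : Continuous fun x => (w x ^ 2 - 1) ^ 2 := by fun_prop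
  have hpot : ∫ x in c..d, (w x ^ 2 - 1) ^ 2 ≤ ε * ∫ x in c..d, e x := by
    rw [← intervalIntegral.integral_const_mul]
    refine intervalIntegral.integral_mono_on hcd (hWc.intervalIntegrable _ _) (he.const_mul ε)
      fun x _ => ?_
    have h3 : 0 ≤ ε * (ε ^ 3 * |v x| ^ 2) := by positivity
    have h4 : ε * (ε⁻¹ * (w x ^ 2 - 1) ^ 2) = (w x ^ 2 - 1) ^ 2 := by field_simp
    simp only [hedef]
    linarith
  have hsub : ∀ r s, c ≤ r → r ≤ s → s ≤ d →
      ∫ x in r..s, (w x ^ 2 - 1) ^ 2 ≤ ∫ x in c..d, (w x ^ 2 - 1) ^ 2 := fun r s hr hrs hs =>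
    intervalIntegral.integral_mono_interval hr hrs hs
          (ae_of_all _ fun t => sq_nonneg _) (hWc.intervalIntegrable _ _)
  have hlow : 49 / 256 * (ℓ / 4) ≤ ∫ x in c..d, (w x ^ 2 - 1) ^ 2 := by
    by_cases hside : x₀ + ℓ ≤ d
    · have h3 := le_integral_doubleWell_of_near_linear (W := fun t => w (x₀ + t)) (m := w' x₀) hℓ0
        (by fun_prop) fun t ht => by
          have := hlin (x₀ + t) ⟨by linarith [hx₀.1, ht.1], by linarith [ht.2]⟩
            (by rw [add_sub_cancel_left, abs_of_nonneg ht.1]; exact ht.2)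
          rwa [add_sub_cancel_left] at this
      rw [intervalIntegral.integral_comp_add_left (fun x => (w x ^ 2 - 1) ^ 2)] at h3
      exact h3.trans (hsub _ _ (by linarith [hx₀.1]) (by linarith) hside)
    · have h3 := le_integral_doubleWell_of_near_linear (W := fun t => w (x₀ - t)) (m := -w' x₀) hℓ0
        (by fun_prop) fun t ht => by
          have := hlin (x₀ - t) ⟨by linarith [hx₀.1, ht.2], by linarith [hx₀.2, ht.1]⟩
            (by rw [sub_sub_cancel_left, abs_neg, abs_of_nonneg ht.1]; exact ht.2)
          rwa [sub_sub_cancel_left, mul_neg, ← neg_mul] at this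
      rw [intervalIntegral.integral_comp_sub_left (fun x => (w x ^ 2 - 1) ^ 2)] at h3
      exact h3.trans (hsub _ _ (by linarith) (by linarith) (by linarith [hx₀.2]))
  nlinarith

/-! ### Products of sign steps -/

/-- The sign of a real number, with the convention that `0` has sign `1`, so that the values are
always `±1`. -/
noncomputable def unitSign (y : ℝ) : ℝ := if 0 ≤ y then 1 else -1

lemma unitSign_mul_self (y : ℝ) : unitSign y * unitSign y = 1 := by
  unfold unitSign; split_ifs <;> norm_num

lemma unitSign_mul_of_ne {x y : ℝ} (h : unitSign x ≠ unitSign y) :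
    unitSign x * unitSign y = -1 := by
  unfold unitSign at *; split_ifs at * <;> simp_all

lemma abs_sub_unitSign (y : ℝ) : |y - unitSign y| = |(|y| - 1)| := by
  unfold unitSign
  split_ifs with h
  · rw [abs_of_nonneg h]
  · rw [abs_of_neg (not_le.1 h), ← abs_neg]; congr 1; ring

lemma exists_zero_of_unitSign_ne {w : ℝ → ℝ} (hw : Continuous w) {x y : ℝ} (hxy : x ≤ y)
    (h : unitSign (w x) ≠ unitSign (w y)) : ∃ z ∈ Icc x y, w z = 0 := by
  unfold unitSign at h
  split_ifs at h with h1 h2 h2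
  · exact absurd rfl h
  · exact intermediate_value_Icc' hxy hw.continuousOn ⟨(not_le.1 h2).le, h1⟩
  · exact intermediate_value_Icc hxy hw.continuousOn ⟨(not_le.1 h1).le, h2⟩
  · exact absurd rfl h

/-- The function of `x` that is `1` to the left of `t` and `-1` from `t` on. On `[a, b)` it is the
constant `-1` for `t = a` and the constant `1` for `t = b`. -/
noncomputable def signStep (t x : ℝ) : ℝ := if t ≤ x then -1 else 1

/-- The product of the functions `signStep (t i)`. Every function on `[a, b)` with values `±1` that
is right-continuous and has fewer than `K` jumps is of this form. -/
noncomputable def signSteps {K : ℕ} (t : Fin K → ℝ) (x : ℝ) : ℝ := ∏ i, signStep (t i) x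

lemma signStep_mem (t x : ℝ) : signStep t x ∈ ({-1, 1} : Set ℝ) := by
  unfold signStep; split_ifs <;> simp

lemma signSteps_mem {K : ℕ} (t : Fin K → ℝ) (x : ℝ) : signSteps t x ∈ ({-1, 1} : Set ℝ) := by
  refine Finset.prod_induction _ (· ∈ ({-1, 1} : Set ℝ)) ?_ (by simp) fun i _ => signStep_mem _ _
  rintro _ _ (rfl | rfl) (rfl | rfl) <;> norm_num

lemma abs_signSteps {K : ℕ} (t : Fin K → ℝ) (x : ℝ) : |signSteps t x| = 1 := by
  rcases signSteps_mem t x with h | h <;> rw [h] <;> norm_num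

lemma measurable_signSteps {K : ℕ} (t : Fin K → ℝ) : Measurable (signSteps t) :=
  Finset.measurable_fun_prod _ fun _ _ =>
    Measurable.ite measurableSet_Ici measurable_const measurable_const

lemma boundedVariationOn_signStep (t : ℝ) (s : Set ℝ) : BoundedVariationOn (signStep t) s := by
  have hneg : BoundedVariationOn (fun x => -signStep t x) s := by
    refine MonotoneOn.boundedVariationOn (C := 1) (fun x _ y _ hxy => ?_) fun x _ => ?_
    · unfold signStep
      split_ifs with h1 h2 h2
      exacts [le_rfl, absurd (h1.trans hxy) h2, by norm_num, le_rfl]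
    · rcases signStep_mem t x with h | h <;> rw [h] <;> norm_num
  have hc : BoundedVariationOn (fun _ : ℝ => (-1 : ℝ)) s := by
    refine MonotoneOn.boundedVariationOn (C := 1) (fun x _ y _ hxy => le_rfl) fun x _ => by norm_num
  convert hc.mul hneg using 1
  ext x
  simp

lemma boundedVariationOn_signSteps {K : ℕ} (t : Fin K → ℝ) (s : Set ℝ) :
    BoundedVariationOn (signSteps t) s := by
  induction K with
  | zero =>
    refine MonotoneOn.boundedVariationOn (C := 1) (fun x _ y _ hxy => ?_) fun x _ => ?_
    all_goals simp [signSteps]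
  | succ K ih =>
    have : signSteps t = signStep (t 0) * signSteps (fun i => t i.succ) := by
      ext x
      simp [signSteps, Fin.prod_univ_succ]
    rw [this]
    exact (boundedVariationOn_signStep _ s).mul (ih _)

/-- At a point that is not a jump of the limit, `signSteps` is eventually constant. -/
lemma tendsto_signSteps {K : ℕ} {t : ℕ → Fin K → ℝ} {s : Fin K → ℝ} (h : Tendsto t atTop (𝓝 s))
    {x : ℝ} (hx : ∀ i, s i ≠ x) :
    Tendsto (fun n => signSteps (t n) x) atTop (𝓝 (signSteps s x)) := by
  refine tendsto_finsetProd _ fun i _ => tendsto_const_nhds.congr' ?_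
  have hi : Tendsto (fun n => t n i) atTop (𝓝 (s i)) := (tendsto_pi_nhds.1 h) i
  unfold signStep
  rcases lt_or_gt_of_ne (hx i) with hlt | hlt
  · filter_upwards [hi.eventually (gt_mem_nhds hlt)] with n hn
    rw [if_pos hlt.le, if_pos hn.le]
  · filter_upwards [hi.eventually (lt_mem_nhds hlt)] with n hn
    rw [if_neg (not_le.2 hlt), if_neg (not_le.2 hn)]

/-- A product of at most `K` steps is a product of exactly `K` steps on `(-∞, b)`, the missing
ones being placed at `b`. -/
lemma exists_signSteps_eq_prod {ι : Type*} {a b : ℝ} (hab : a ≤ b) (K : ℕ) (S : Finset ι)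
    (hS : S.card ≤ K) (g : ι → ℝ) (hg : ∀ i ∈ S, g i ∈ Icc a b) :
    ∃ t : Fin K → ℝ, (∀ i, t i ∈ Icc a b) ∧
      ∀ x < b, signSteps t x = ∏ i ∈ S, signStep (g i) x := by
  classical
  induction K generalizing S with
  | zero =>
    rw [Nat.le_zero, Finset.card_eq_zero] at hS
    subst hS
    exact ⟨fun _ => b, fun i => i.elim0, fun x _ => by simp [signSteps]⟩
  | succ K ih =>
    rcases S.eq_empty_or_nonempty with rfl | ⟨j, hj⟩
    · refine ⟨fun _ => b, fun _ => right_mem_Icc.2 hab, fun x hx => ?_⟩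
      simp [signSteps, signStep, not_le.2 hx]
    · obtain ⟨t, ht, hp⟩ := ih (S.erase j) (by rw [Finset.card_erase_of_mem hj]; omega)
        fun i hi => hg i (Finset.mem_of_mem_erase hi)
      refine ⟨Fin.cons (g j) t, Fin.cases (hg j hj) ht, fun x hx => ?_⟩
      rw [← Finset.mul_prod_erase S _ hj, ← hp x hx]
      simp [signSteps, Fin.prod_univ_succ]

/-- A `±1`-valued sequence is recovered from its first value and its sign changes. -/
lemma eq_mul_prod_of_mul_self_eq_one {σ : ℕ → ℝ} (hσ : ∀ i, σ i * σ i = 1) (j : ℕ) :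
    σ j = σ 0 * ∏ i ∈ Finset.range j, σ i * σ (i + 1) := by
  induction j with
  | zero => simp
  | succ j ih =>
    rw [Finset.prod_range_succ, ← mul_assoc, ← ih, ← mul_assoc, hσ, one_mul]

/-- A function on `[a, b)` that is constant on the cells of a regular grid, with values the signs of
a sequence having at most `K` sign changes, is a product of `K + 1` steps: one for each sign change,
and one at `a` or at `b` for the initial sign. -/
lemma exists_signSteps_eq_on_cells {a b h : ℝ} {N K : ℕ} (hh : 0 < h) (hN : a + N * h = b)
    (s : ℕ → ℝ)
    (hK : ((Finset.range N).filter fun i => unitSign (s i) ≠ unitSign (s (i + 1))).card ≤ K) :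
    ∃ t : Fin (K + 1) → ℝ, (∀ i, t i ∈ Icc a b) ∧ ∀ j < N, ∀ x ∈ Ico (a + j * h) (a + (j + 1) * h),
      signSteps t x = unitSign (s j) := by
  have hab : a ≤ b := by rw [← hN]; nlinarith [(Nat.cast_nonneg N : (0 : ℝ) ≤ N)]
  have hle : ∀ i : ℕ, i < N → a + (i + 1 : ℝ) * h ≤ b := fun i hi => by
    rw [← hN]
    have : (i + 1 : ℝ) ≤ N := by exact_mod_cast hi
    nlinarith
  obtain ⟨t, ht, hp⟩ := exists_signSteps_eq_prod hab K _ hK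
    (fun i : ℕ => a + (i + 1) * h) (fun i hi => by
      rw [Finset.mem_filter, Finset.mem_range] at hi
      exact ⟨by nlinarith [(Nat.cast_nonneg i : (0 : ℝ) ≤ i)], hle i hi.1⟩)
  have h0 : (if 0 ≤ s 0 then b else a) ∈ Icc a b := by
    split_ifs
    exacts [right_mem_Icc.2 hab, left_mem_Icc.2 hab]
  refine ⟨Fin.cons (if 0 ≤ s 0 then b else a) t, Fin.cases h0 ht, fun j hj x hx => ?_⟩
  have hxb : x < b := hx.2.trans_le (hle j hj)
  have hax : a ≤ x := le_trans (by nlinarith [(Nat.cast_nonneg j : (0 : ℝ) ≤ j)]) hx.1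
  rw [eq_mul_prod_of_mul_self_eq_one (σ := fun i => unitSign (s i))
    (fun i => unitSign_mul_self _) j]
  have e1 : signSteps (Fin.cons (if 0 ≤ s 0 then b else a) t : Fin (K + 1) → ℝ) x
      = signStep (if 0 ≤ s 0 then b else a) x * signSteps t x := by
    simp [signSteps, Fin.prod_univ_succ]
  rw [e1, hp x hxb]
  congr 1
  · unfold signStep unitSign
    by_cases h1 : 0 ≤ s 0
    · rw [if_pos h1, if_pos h1, if_neg (not_le.2 hxb)]
    · rw [if_neg h1, if_neg h1, if_pos hax]
  · have hr : (Finset.range N).filter (· < j) = Finset.range j := by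
      ext i
      simp only [Finset.mem_filter, Finset.mem_range]
      omega
    rw [← hr, Finset.prod_filter, Finset.prod_filter]
    refine Finset.prod_congr rfl fun i _ => ?_
    have hij : a + (i + 1 : ℝ) * h ≤ x ↔ i < j := by
      constructor
      · intro hle
        have h3 : (i + 1 : ℝ) * h < (j + 1) * h := by linarith [hx.2]
        have h4 := lt_of_mul_lt_mul_right h3 hh.le
        have : i + 1 < j + 1 := by exact_mod_cast h4
        omega
      · intro hlt
        have : (i + 1 : ℝ) ≤ j := by exact_mod_cast hlt
        nlinarith [hx.1]
    unfold signStep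
    rw [if_congr hij rfl rfl]
    by_cases h5 : unitSign (s i) = unitSign (s (i + 1))
    · simp [h5, unitSign_mul_self]
    · simp [h5, unitSign_mul_of_ne h5]

/-- If `w` has energy at most `M`, some product of `K + 1` sign steps, `K ≥ 64 M`, has the sign of
`w` outside a set of measure at most `2 ε K`, the union of the cells in which `w` has a zero. -/
lemma exists_signSteps_approx {a b : ℝ} {w w' v : ℝ → ℝ}
    (hw : ∀ x, HasDerivAt w (w' x) x) (hv : Integrable v)
    (hw' : ∀ x y, w' y - w' x = ∫ t in x..y, v t) {ε : ℝ} (hε : 0 < ε) (hεab : ε ≤ b - a)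
    (he : IntervalIntegrable (fun x => ε⁻¹ * (w x ^ 2 - 1) ^ 2 + ε ^ 3 * |v x| ^ 2) volume a b)
    {M : ℝ} (hM : ∫ x in a..b, (ε⁻¹ * (w x ^ 2 - 1) ^ 2 + ε ^ 3 * |v x| ^ 2) ≤ M)
    {K : ℕ} (hK : 64 * M ≤ K) :
    ∃ t : Fin (K + 1) → ℝ, (∀ i, t i ∈ Icc a b) ∧ ∃ B : Set ℝ, MeasurableSet B ∧
      volume B ≤ ENNReal.ofReal (2 * ε * K) ∧
      ∀ x ∈ Ioo a b, x ∉ B → |w x - signSteps t x| = |(|w x| - 1)| := by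
  classical
  have hwc : Continuous w := continuous_iff_continuousAt.2 fun x => (hw x).continuousAt
  set e : ℝ → ℝ := fun x => ε⁻¹ * (w x ^ 2 - 1) ^ 2 + ε ^ 3 * |v x| ^ 2 with hedef
  have he0 : ∀ x, 0 ≤ e x := fun x => by positivity
  -- `N` cells of length `h = (b - a) / N`, which lies between `ε` and `2 ε` as `ε ≤ b - a`.
  set N := ⌊(b - a) / ε⌋₊ with hN
  have hq : 1 ≤ (b - a) / ε := (one_le_div hε).2 hεab
  have hN1 : 1 ≤ N := Nat.one_le_floor_iff _ |>.2 hq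
  have hN1' : (1 : ℝ) ≤ N := by exact_mod_cast hN1
  have hN0 : (0 : ℝ) < N := by linarith
  have hfl : (N : ℝ) ≤ (b - a) / ε := Nat.floor_le (by linarith)
  have hfl' : (b - a) / ε < N + 1 := Nat.lt_floor_add_one _
  rw [le_div_iff₀ hε] at hfl
  rw [div_lt_iff₀ hε] at hfl'
  set h := (b - a) / N with hh
  have hNh : N * h = b - a := by rw [hh]; field_simp
  have hεh : ε ≤ h := by rw [hh, le_div_iff₀ hN0]; linarith
  have hh2 : h ≤ 2 * ε := by rw [hh, div_le_iff₀ hN0]; nlinarith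
  have hh0 : 0 < h := by linarith
  set g : ℕ → ℝ := fun i => a + i * h with hg
  have hg1 : ∀ i, g (i + 1) - g i = h := fun i => by simp only [hg]; push_cast; ring
  have hgm : ∀ i, i ≤ N → g i ∈ Icc a b := fun i hi => by
    have : (i : ℝ) ≤ N := by exact_mod_cast hi
    constructor
    · simp only [hg]; nlinarith [(Nat.cast_nonneg i : (0 : ℝ) ≤ i)]
    · simp only [hg]; nlinarith
  have hab : a ≤ b := by linarith
  have hint : ∀ i < N, IntervalIntegrable e volume (g i) (g (i + 1)) := fun i hi =>
    he.mono_set (by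
      rw [uIcc_of_le hab, uIcc_of_le (by linarith [hg1 i])]
      exact Icc_subset_Icc (hgm i hi.le).1 (hgm (i + 1) hi).2)
  set A := (Finset.range N).filter fun i => ∃ z ∈ Icc (g i) (g (i + 1)), w z = 0 with hA
  have hAcard : A.card ≤ K := by
    have h1 : (A.card : ℝ) * (1 / 64) ≤ M := calc
      (A.card : ℝ) * (1 / 64) = ∑ _i ∈ A, (1 / 64 : ℝ) := by simp
      _ ≤ ∑ i ∈ A, ∫ x in g i..g (i + 1), e x := by
        refine Finset.sum_le_sum fun i hi => ?_
        rw [hA, Finset.mem_filter, Finset.mem_range] at hi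
        obtain ⟨hiN, z, hz, hz0⟩ := hi
        exact energy_cell_ge_of_zero hw hv hw' hε (by rw [hg1]; exact hεh) (by rw [hg1]; exact hh2)
          (hint i hiN) hz hz0
      _ ≤ ∑ i ∈ Finset.range N, ∫ x in g i..g (i + 1), e x :=
        Finset.sum_le_sum_of_subset_of_nonneg (Finset.filter_subset _ _) fun i _ _ =>
          intervalIntegral.integral_nonneg (by linarith [hg1 i]) fun x _ => he0 x
      _ = ∫ x in a..b, e x := by
        rw [intervalIntegral.sum_integral_adjacent_intervals hint]
        congr 1
        · simp [hg]
        · simp only [hg]; linarith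
      _ ≤ M := hM
    have : (A.card : ℝ) ≤ K := by linarith
    exact_mod_cast this
  -- By the intermediate value theorem, the sign at consecutive grid points can differ only if the
  -- cell between them contains a zero.
  obtain ⟨t, ht, hcell⟩ := exists_signSteps_eq_on_cells (N := N) (K := K) hh0
    (by linarith : a + N * h = b) (fun i => w (g i)) (le_trans (Finset.card_le_card (by
      intro i hi
      rw [Finset.mem_filter] at hi
      exact Finset.mem_filter.2
        ⟨hi.1, exists_zero_of_unitSign_ne hwc (by linarith [hg1 i]) hi.2⟩)) hAcard)
  refine ⟨t, ht, ⋃ i ∈ A, Icc (g i) (g (i + 1)),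
    Finset.measurableSet_biUnion _ fun i _ => measurableSet_Icc, ?_, ?_⟩
  · calc volume (⋃ i ∈ A, Icc (g i) (g (i + 1)))
        ≤ ∑ i ∈ A, volume (Icc (g i) (g (i + 1))) := measure_biUnion_finset_le _ _
      _ = A.card * ENNReal.ofReal h := by simp [hg1]
      _ ≤ K * ENNReal.ofReal (2 * ε) := by gcongr
      _ = ENNReal.ofReal (2 * ε * K) := by
        rw [ENNReal.ofReal_mul (p := 2 * ε) (by linarith), ENNReal.ofReal_natCast, mul_comm]
  · intro x hx hxB
    set j := ⌊(x - a) / h⌋₊ with hj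
    have hxa : 0 ≤ (x - a) / h := div_nonneg (by linarith [hx.1]) hh0.le
    have h1 : (j : ℝ) * h ≤ x - a := (le_div_iff₀ hh0).1 (Nat.floor_le hxa)
    have h2 : x - a < (j + 1) * h := (div_lt_iff₀ hh0).1 (Nat.lt_floor_add_one _)
    have hjN : j < N := by
      have h3 : (j : ℝ) * h < N * h := by rw [hNh]; linarith [hx.2]
      exact_mod_cast lt_of_mul_lt_mul_right h3 hh0.le
    have hgj : g j ≤ x := by simp only [hg]; linarith
    have hgj' : x < g (j + 1) := by simp only [hg]; push_cast; linarith
    rw [hcell j hjN x ⟨by linarith, by linarith⟩, ← abs_sub_unitSign]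
    congr 2
    by_contra hne
    obtain ⟨z, hz, hz0⟩ := exists_zero_of_unitSign_ne hwc hgj hne
    refine hxB (mem_biUnion (x := j) ?_ ⟨hgj, hgj'.le⟩)
    exact Finset.mem_filter.2 ⟨Finset.mem_range.2 hjN, z, ⟨hz.1, hz.2.trans hgj'.le⟩, hz0⟩

/-! ### Approximation in `L⁴` and compactness -/

/-- If `|y - z|` is at most the distance of `|y|` to `1`, as it is when `z` is the sign of `y`, then
its fourth power is at most the double-well potential. -/
lemma sub_pow_four_le {y z : ℝ} (h : |y - z| ≤ |(|y| - 1)|) : |y - z| ^ 4 ≤ (y ^ 2 - 1) ^ 2 := by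
  have h1 : |(|y| - 1)| ^ 2 ≤ |y ^ 2 - 1| := by
    rw [← sq_abs y, show |y| ^ 2 - 1 = (|y| - 1) * (|y| + 1) by ring, abs_mul, sq]
    refine mul_le_mul_of_nonneg_left ?_ (abs_nonneg _)
    rw [abs_of_nonneg (by positivity : 0 ≤ |y| + 1), abs_le]
    constructor <;> linarith [abs_nonneg y]
  calc |y - z| ^ 4 ≤ |(|y| - 1)| ^ 4 := by gcongr
    _ = (|(|y| - 1)| ^ 2) ^ 2 := by ring
    _ ≤ |y ^ 2 - 1| ^ 2 := by gcongr
    _ = _ := sq_abs _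

/-- The cruder bound that holds when `z = ±1` need not be the sign of `y`. -/
lemma sub_pow_four_le_add {y z : ℝ} (hz : |z| = 1) :
    |y - z| ^ 4 ≤ 8 * (y ^ 2 - 1) ^ 2 + 128 := by
  have h0 := sub_pow_four_le (abs_sub_unitSign y).le
  have h1 : |y - z| ≤ |y - unitSign y| + 2 := by
    have h2 : |unitSign y| = 1 := by unfold unitSign; split_ifs <;> norm_num
    have h3 : |y - z| ≤ |y - unitSign y| + |unitSign y - z| := abs_sub_le _ _ _
    have h4 : |unitSign y - z| ≤ |unitSign y| + |z| := abs_sub _ _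
    linarith
  have h5 : ∀ s : ℝ, 0 ≤ s → (s + 2) ^ 4 ≤ 8 * s ^ 4 + 128 := fun s hs => by
    nlinarith [mul_nonneg hs hs, sq_nonneg (s - 2), sq_nonneg (s ^ 2 - 4),
      mul_nonneg (sq_nonneg (s - 2)) (mul_nonneg hs hs), mul_nonneg (sq_nonneg (s - 2)) hs]
  calc |y - z| ^ 4 ≤ (|y - unitSign y| + 2) ^ 4 := by gcongr
    _ ≤ 8 * |y - unitSign y| ^ 4 + 128 := h5 _ (abs_nonneg _)
    _ ≤ _ := by linarith

/-- A function of energy at most `M` is at distance `O(ε ^ (1 / 4))` in `L⁴` from a product of a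
number of sign steps that depends only on `M`. -/
lemma lintegral_sub_signSteps_le {a b : ℝ} {p : ℝ≥0∞} [Fact (1 ≤ p)] {ε : ℝ} (hε : 0 < ε)
    (hεab : ε ≤ b - a) {u : LpOn (Ioo a b) p} {M : ℝ} (hM0 : 0 ≤ M)
    (hM : secondOrderEnergy ε u ≤ ENNReal.ofReal M) {K : ℕ} (hK : 64 * M ≤ K) :
    ∃ t : Fin (K + 1) → ℝ, (∀ i, t i ∈ Icc a b) ∧
      ∫⁻ x in Ioo a b, ‖u x - signSteps t x‖ₑ ^ (4 : ℝ) ≤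
        ENNReal.ofReal ((8 * M + 256 * K) * ε) := by
  have hab : a < b := by linarith
  have hS : MemSobolev 2 u := by
    by_contra h
    rw [secondOrderEnergy, if_neg h] at hM
    exact absurd hM (by simp)
  rw [secondOrderEnergy, if_pos hS] at hM
  obtain ⟨w, w', huw, hw, hvi, hw'⟩ := exists_C1_representative hab hS
  have hwc : Continuous w := continuous_iff_continuousAt.2 fun x => (hw x).continuousAt
  set v := (Ioo a b).indicator (weakDeriv 2 u) with hv
  set e : ℝ → ℝ := fun x => ε⁻¹ * (w x ^ 2 - 1) ^ 2 + ε ^ 3 * |v x| ^ 2 with hedef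
  have he0 : ∀ x, 0 ≤ e x := fun x => by positivity
  have heM : ∫⁻ x in Ioo a b, ENNReal.ofReal (e x) ≤ ENNReal.ofReal M := by
    refine le_of_eq_of_le (lintegral_congr_ae ?_) hM
    filter_upwards [huw, ae_restrict_mem measurableSet_Ioo] with x hx hxm
    simp only [hedef, hv, hx, indicator_of_mem hxm]
  have hem : AEStronglyMeasurable e (volume.restrict (Ioo a b)) := by
    have h1 : AEStronglyMeasurable (fun x => ε⁻¹ * (w x ^ 2 - 1) ^ 2)
      (volume.restrict (Ioo a b)) := (by fun_prop : Continuous _).aestronglyMeasurable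
    have h2 : AEMeasurable v (volume.restrict (Ioo a b)) :=
      hvi.aestronglyMeasurable.aemeasurable.restrict
    have h3 : AEMeasurable (fun x => ε ^ 3 * |v x| ^ 2) (volume.restrict (Ioo a b)) := by
      simp only [sq_abs]
      exact (h2.pow_const 2).const_mul _
    exact h1.add h3.aestronglyMeasurable
  have hei : IntegrableOn e (Ioo a b) := by
    refine ⟨hem, ?_⟩
    rw [hasFiniteIntegral_iff_ofReal (ae_of_all _ he0)]
    exact heM.trans_lt ENNReal.ofReal_lt_top
  have heM' : ∫ x in a..b, e x ≤ M := by
    rw [intervalIntegral.integral_of_le hab.le, integral_Ioc_eq_integral_Ioo]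
    rw [← ofReal_integral_eq_lintegral_ofReal hei (ae_of_all _ he0)] at heM
    exact (ENNReal.ofReal_le_ofReal_iff hM0).1 heM
  obtain ⟨t, ht, B, hB, hBvol, hBz⟩ := exists_signSteps_approx hw hvi hw' hε hεab
    ((intervalIntegrable_iff_integrableOn_Ioo_of_le hab.le).2 hei) heM' hK
  refine ⟨t, ht, ?_⟩
  have hpt : ∀ᵐ x ∂volume.restrict (Ioo a b), ‖u x - signSteps t x‖ₑ ^ (4 : ℝ) ≤
      ENNReal.ofReal (8 * ε) * ENNReal.ofReal (e x) + B.indicator (fun _ => 128) x := by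
    filter_upwards [huw, ae_restrict_mem measurableSet_Ioo] with x hx hxm
    have h1 : (w x ^ 2 - 1) ^ 2 ≤ ε * e x := by
      have h3 : 0 ≤ ε * (ε ^ 3 * |v x| ^ 2) := by positivity
      have h4 : ε * (ε⁻¹ * (w x ^ 2 - 1) ^ 2) = (w x ^ 2 - 1) ^ 2 := by field_simp
      simp only [hedef]
      linarith
    have h2 : ‖u x - signSteps t x‖ₑ ^ (4 : ℝ) = ENNReal.ofReal (|w x - signSteps t x| ^ 4) := by
      rw [hx, Real.enorm_eq_ofReal_abs, ENNReal.ofReal_pow (abs_nonneg _)]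
      exact_mod_cast ENNReal.rpow_natCast _ 4
    rw [h2, ← ENNReal.ofReal_mul (by linarith)]
    by_cases hxB : x ∈ B
    · rw [indicator_of_mem hxB, show (128 : ℝ≥0∞) = ENNReal.ofReal 128 by simp,
        ← ENNReal.ofReal_add (mul_nonneg (by linarith) (he0 x)) (by norm_num)]
      refine ENNReal.ofReal_le_ofReal ?_
      have := sub_pow_four_le_add (y := w x) (abs_signSteps t x)
      linarith
    · rw [indicator_of_notMem hxB, add_zero]
      refine ENNReal.ofReal_le_ofReal ?_
      have h5 := sub_pow_four_le (hBz x hxm hxB).le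
      have := mul_nonneg hε.le (he0 x)
      linarith
  calc ∫⁻ x in Ioo a b, ‖u x - signSteps t x‖ₑ ^ (4 : ℝ)
      ≤ ∫⁻ x in Ioo a b,
          (ENNReal.ofReal (8 * ε) * ENNReal.ofReal (e x) + B.indicator (fun _ => 128) x) :=
        lintegral_mono_ae hpt
    _ = ENNReal.ofReal (8 * ε) * (∫⁻ x in Ioo a b, ENNReal.ofReal (e x)) +
          128 * volume.restrict (Ioo a b) B := by
        rw [lintegral_add_right _ (measurable_const.indicator hB),
          lintegral_const_mul' _ _ ENNReal.ofReal_ne_top, lintegral_indicator_const hB]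
    _ ≤ ENNReal.ofReal (8 * ε) * ENNReal.ofReal M + 128 * ENNReal.ofReal (2 * ε * K) := by
        gcongr
        exact (Measure.restrict_apply_le _ _).trans hBvol
    _ = ENNReal.ofReal ((8 * M + 256 * K) * ε) := by
        rw [show (128 : ℝ≥0∞) = ENNReal.ofReal 128 by simp, ← ENNReal.ofReal_mul (by linarith),
          ← ENNReal.ofReal_mul (by norm_num), ← ENNReal.ofReal_add (by positivity) (by positivity)]
        congr 1
        ring

lemma tendsto_eLpNorm_four_of_tendsto_lintegral {α : Type*} [MeasurableSpace α] {μ : Measure α}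
    {f : ℕ → α → ℝ} (h : Tendsto (fun n => ∫⁻ x, ‖f n x‖ₑ ^ (4 : ℝ) ∂μ) atTop (𝓝 0)) :
    Tendsto (fun n => eLpNorm (f n) 4 μ) atTop (𝓝 0) := by
  have h4 : (4 : ℝ≥0∞).toReal = 4 := by simp
  simp_rw [eLpNorm_eq_lintegral_rpow_enorm_toReal (by simp : (4 : ℝ≥0∞) ≠ 0)
    (by simp : (4 : ℝ≥0∞) ≠ ⊤), h4]
  have := h.ennrpow_const (1 / 4 : ℝ)
  rwa [ENNReal.zero_rpow_of_pos (by norm_num)] at this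

/-- Products of sign steps depend continuously in `L⁴` on the positions of the steps. -/
lemma tendsto_eLpNorm_signSteps_sub {a b : ℝ} {K : ℕ} {t : ℕ → Fin K → ℝ} {s : Fin K → ℝ}
    (h : Tendsto t atTop (𝓝 s)) :
    Tendsto (fun n => eLpNorm (signSteps (t n) - signSteps s) 4 (volume.restrict (Ioo a b)))
      atTop (𝓝 0) := by
  refine tendsto_eLpNorm_four_of_tendsto_lintegral ?_
  have hae : ∀ᵐ x ∂volume.restrict (Ioo a b), ∀ i, s i ≠ x :=
    ae_all_iff.2 fun i => (Measure.ae_ne _ (s i)).mono fun x hx => hx.symm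
  have := tendsto_lintegral_of_dominated_convergence (μ := volume.restrict (Ioo a b))
    (F := fun n x => ‖(signSteps (t n) - signSteps s) x‖ₑ ^ (4 : ℝ)) (f := fun _ => 0)
    (fun _ => 2 ^ (4 : ℝ))
    (fun n => ((measurable_signSteps _).sub (measurable_signSteps _)).enorm.pow_const _)
    (fun n => ae_of_all _ fun x => ?_) ?_ ?_
  · simpa using this
  · refine ENNReal.rpow_le_rpow ?_ (by norm_num)
    refine (enorm_sub_le).trans ?_
    simp only [Real.enorm_eq_ofReal_abs, abs_signSteps]
    norm_num
  · simp [ENNReal.mul_eq_top]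
  · filter_upwards [hae] with x hx
    have h1 := (tendsto_signSteps h hx).sub_const (signSteps s x)
    rw [sub_self] at h1
    have h2 := (h1.enorm).ennrpow_const (4 : ℝ)
    rwa [enorm_zero, ENNReal.zero_rpow_of_pos (by norm_num)] at h2

theorem theorem2 (a b : ℝ) (hab : a < b) (p : ℝ≥0∞) [Fact (1 ≤ p)] (hp4 : p ≤ 4)
    (ε : ℕ → ℝ) (hε_pos : ∀ n, 0 < ε n) (hε_lim : Tendsto ε atTop (𝓝 0))
    (u : ℕ → LpOn (Ioo a b) p)
    (hbound : (⨆ n, secondOrderEnergy (ε n) (u n)) < ⊤) :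
    ∃ φ : ℕ → ℕ, StrictMono φ ∧ ∃ v : LpOn (Ioo a b) p,
      MemBPV {-1, 1} v ∧ Tendsto (fun k => u (φ k)) atTop (𝓝 v) := by
  set M := (⨆ n, secondOrderEnergy (ε n) (u n)).toReal with hMdef
  have hM0 : 0 ≤ M := ENNReal.toReal_nonneg
  have hM : ∀ n, secondOrderEnergy (ε n) (u n) ≤ ENNReal.ofReal M := fun n => by
    rw [hMdef, ENNReal.ofReal_toReal hbound.ne]
    exact le_iSup (fun n => secondOrderEnergy (ε n) (u n)) n
  obtain ⟨K, hK⟩ := exists_nat_ge (64 * M)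
  have hex : ∀ n, ∃ t : Fin (K + 1) → ℝ, (∀ i, t i ∈ Icc a b) ∧ (ε n ≤ b - a →
      ∫⁻ x in Ioo a b, ‖u n x - signSteps t x‖ₑ ^ (4 : ℝ) ≤
        ENNReal.ofReal ((8 * M + 256 * K) * ε n)) := fun n => by
    by_cases hn : ε n ≤ b - a
    · obtain ⟨t, ht, h⟩ := lintegral_sub_signSteps_le (hε_pos n) hn hM0 (hM n) hK
      exact ⟨t, ht, fun _ => h⟩
    -- The finitely many `n` with `ε n > b - a` do not affect the limit.
    · exact ⟨fun _ => a, fun _ => left_mem_Icc.2 hab.le, fun h => absurd h hn⟩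
  choose t ht hest using hex
  obtain ⟨s, -, φ, hφ, hs⟩ := (isCompact_Icc (a := fun _ : Fin (K + 1) => a) (b := fun _ => b)
    ).tendsto_subseq (x := t) fun n => ⟨fun i => (ht n i).1, fun i => (ht n i).2⟩
  have hmem : MemLp (signSteps s) p (volume.restrict (Ioo a b)) :=
    MemLp.of_bound (measurable_signSteps s).aestronglyMeasurable 1
      (ae_of_all _ fun x => (abs_signSteps s x).le)
  refine ⟨φ, hφ, hmem.toLp _, ⟨signSteps s, hmem.coeFn_toLp, fun x _ => signSteps_mem s x,
    boundedVariationOn_signSteps s _⟩, ?_⟩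
  rw [Lp.tendsto_Lp_iff_tendsto_eLpNorm]
  have hclose : Tendsto (fun n => eLpNorm (⇑(u n) - signSteps (t n)) 4 (volume.restrict (Ioo a b)))
      atTop (𝓝 0) := by
    refine tendsto_eLpNorm_four_of_tendsto_lintegral ?_
    have hlim : Tendsto (fun n => ENNReal.ofReal ((8 * M + 256 * K) * ε n)) atTop (𝓝 0) := by
      have := ENNReal.tendsto_ofReal (hε_lim.const_mul (8 * M + 256 * K))
      simpa using this
    refine tendsto_of_tendsto_of_tendsto_of_le_of_le' tendsto_const_nhds hlim
      (Eventually.of_forall fun _ => zero_le) ?_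
    filter_upwards [hε_lim.eventually (gt_mem_nhds (sub_pos.2 hab))] with n hn
    exact hest n hn.le
  have hmeas : ∀ n, AEStronglyMeasurable (u n) (volume.restrict (Ioo a b)) := fun n =>
    Lp.aestronglyMeasurable _
  have hzm : ∀ r : Fin (K + 1) → ℝ,
      AEStronglyMeasurable (signSteps r) (volume.restrict (Ioo a b)) := fun r =>
    (measurable_signSteps r).aestronglyMeasurable
  have h4 : Tendsto (fun k => eLpNorm (⇑(u (φ k)) - signSteps s) 4 (volume.restrict (Ioo a b)))
      atTop (𝓝 0) := by
    have hsum := (hclose.comp hφ.tendsto_atTop).add (tendsto_eLpNorm_signSteps_sub (a := a)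
      (b := b) hs)
    rw [add_zero] at hsum
    refine tendsto_of_tendsto_of_tendsto_of_le_of_le tendsto_const_nhds hsum
      (fun _ => zero_le) fun k => ?_
    have := eLpNorm_add_le (p := 4) ((hmeas (φ k)).sub (hzm (t (φ k))))
      ((hzm (t (φ k))).sub (hzm s)) (by norm_num)
    rwa [sub_add_sub_cancel] at this
  have hp0 : 1 ≤ p := Fact.out
  have hexp : 0 ≤ 1 / p.toReal - 1 / (4 : ℝ≥0∞).toReal := by
    have hptop : p ≠ ⊤ := ne_top_of_le_ne_top (by simp) hp4
    have h1 : 0 < p.toReal := ENNReal.toReal_pos (by positivity) hptop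
    have h2 : p.toReal ≤ (4 : ℝ≥0∞).toReal := ENNReal.toReal_mono (by simp) hp4
    exact sub_nonneg.2 (one_div_le_one_div_of_le h1 h2)
  have hvol : volume.restrict (Ioo a b) univ ^ (1 / p.toReal - 1 / (4 : ℝ≥0∞).toReal) ≠ ⊤ :=
    ENNReal.rpow_ne_top_of_nonneg hexp (measure_ne_top _ _)
  have hlim := ENNReal.Tendsto.mul_const h4 (Or.inr hvol)
  rw [zero_mul] at hlim
  exact tendsto_of_tendsto_of_tendsto_of_le_of_le tendsto_const_nhds hlim (fun _ => zero_le)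
    fun k => eLpNorm_le_eLpNorm_mul_rpow_measure_univ hp4 ((hmeas (φ k)).sub (hzm s))
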